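/- Let $J_1=\{J_1(t):t\ge 0\}$ be a subordinator, that is, a Lévy process with $J_1(0)=0$ and almost surely non-decreasing, right-continuous paths, on a probability space, and suppose that $\rho_1=\mathrm{E}J_1(1)<1$. Let $0\le b_2<b_1$, put $a=1-b_2/b_1$ and $J_a(t)=J_1(at)$. For $v>0$ let $$T_0=v,\qquad T_{n+1}=v+J_a(T_n)\quad (n\ge 0),\qquad K=\inf\{n\ge 1:\ T_n=T_{n-1}\},$$ with $\inf\emptyset=\infty$. Call $J_1$ a compound Poisson process if there are a rate $\lambda\ge 0$ and a probability measure $F$ on $\mathbb{R}$ such that for every $t\ge 0$, $J_1(t)$ has the law of $\sum_{i=1}^{N}\xi_i$, where $N$ is Poisson distributed with mean $\lambda t$ and $\xi_1,\xi_2,\dots$ are i.i.d. with law $F$ and independent of $N$ (so there is no drift, and the process that is identically $0$, with $\lambda=0$, is included). Then for every $v>0$: if $J_1$ is a compound Poisson process, then $\mathrm{P}(K<\infty)=1$; otherwise $\mathrm{P}(K=\infty)=1$. -/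

import Mathlib

open MeasureTheory ProbabilityTheory Filter
open scoped NNReal ENNReal Topology

/-- A real-valued Lévy process: started at `0`, with independent and stationary increments and,
almost surely, right-continuous paths with left limits. -/
structure IsLevyProcess {Ω : Type*} [MeasurableSpace Ω] (X : ℝ≥0 → Ω → ℝ) (P : Measure Ω) :
    Prop where
  measurable : ∀ t, Measurable (X t)
  start_zero : ∀ᵐ ω ∂P, X 0 ω = 0
  indep_increments : HasIndepIncrements X P
  stationary_increments : ∀ s t : ℝ≥0,
    IdentDistrib (fun ω => X (s + t) ω - X s ω) (fun ω => X t ω - X 0 ω) P P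
  right_continuous : ∀ᵐ ω ∂P, ∀ t, ContinuousWithinAt (fun s => X s ω) (Set.Ici t) t
  left_limits : ∀ᵐ ω ∂P, ∀ t, ∃ l : ℝ, Tendsto (fun s => X s ω) (𝓝[<] t) (𝓝 l)

/-- A subordinator: a Lévy process with almost surely non-decreasing paths. -/
structure IsSubordinator {Ω : Type*} [MeasurableSpace Ω] (X : ℝ≥0 → Ω → ℝ) (P : Measure Ω) :
    Prop extends IsLevyProcess X P where
  monotone : ∀ᵐ ω ∂P, Monotone (fun t => X t ω)

/-- The law of the sum of `k` independent random variables with law `F`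
(the `k`-fold convolution power of `F`). -/
noncomputable def convPower (F : Measure ℝ) : ℕ → Measure ℝ
  | 0 => Measure.dirac 0
  | k + 1 => (convPower F k).conv F

/-- The compound Poisson law: the law of `ξ₁ + ⋯ + ξ_N`, where `N` is Poisson with mean `r` and
the `ξᵢ` are i.i.d. with law `F` and independent of `N`. -/
noncomputable def compoundPoissonMeasure (r : ℝ≥0) (F : Measure ℝ) : Measure ℝ :=
  Measure.sum (fun k => poissonMeasure r {k} • convPower F k)

/-- A compound Poisson process: a Lévy process that has, for some jump rate `l ≥ 0` and some jump
distribution `F`, the compound Poisson law with parameters `l * t` and `F` at each time `t`.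
The rate may be `0`, so that the process that vanishes identically is included. -/
def IsCompoundPoisson {Ω : Type*} [MeasurableSpace Ω] (X : ℝ≥0 → Ω → ℝ) (P : Measure Ω) : Prop :=
  IsLevyProcess X P ∧ ∃ (l : ℝ≥0) (F : Measure ℝ), IsProbabilityMeasure F ∧
    ∀ t : ℝ≥0, P.map (X t) = compoundPoissonMeasure (l * t) F

/-- The overtaking sequence `T₀ = v`, `T_{n+1} = v + J (a T_n)`. -/
noncomputable def overtakingTime {Ω : Type*} (J : ℝ≥0 → Ω → ℝ) (a v : ℝ) : ℕ → Ω → ℝ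
  | 0, _ => v
  | n + 1, ω => v + J (Real.toNNReal (a * overtakingTime J a v n ω)) ω

/-- `K = inf {n ≥ 1 : T_n = T_{n-1}}`, with value `∞` if there is no such `n`. -/
noncomputable def overtakingCount {Ω : Type*} (J : ℝ≥0 → Ω → ℝ) (a v : ℝ) (ω : Ω) : ℕ∞ :=
  sInf ((fun n : ℕ => (n : ℕ∞)) ''
    {n : ℕ | 1 ≤ n ∧ overtakingTime J a v n ω = overtakingTime J a v (n - 1) ω})

/-! Everything turns on `p = P(J₁(1) = 0)`. Monotone paths and independent stationary increments
make `t ↦ P(J₁(t) = 0)` multiplicative.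

If `p = 0`, almost no path is constant on an interval, so paths are strictly increasing
(`ae_strictMono`). Then `T₁ > T₀` propagates by induction and `K = ∞`.

If `p > 0`, the process is compound Poisson (`IsSubordinator.isCompoundPoisson`): its rate is `-log
p`, and its jump law is a limit point of the laws of `J₁(1/(n+1))` conditioned to be nonzero. Hence
a process that is not compound Poisson has `p = 0`.

A compound Poisson process satisfies `P(J₁(t) ≠ 0) ≤ l t`, so almost surely it takes finitely many
values on bounded intervals (`ae_finite_image_Iic`). By the strong law and mean below `1`, some `M`
has `v + J₁(M) ≤ M`. This bounds all `T_n` by `M`; being monotone with finitely many values, the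
sequence must repeat, and `K < ∞`. -/

/-! ### Compound Poisson laws and elementary limits -/

instance isProbabilityMeasure_convPower (F : Measure ℝ) [IsProbabilityMeasure F] (k : ℕ) :
    IsProbabilityMeasure (convPower F k) := by
  induction k with
  | zero => simp only [convPower]; infer_instance
  | succ k ih => simp only [convPower]; infer_instance

theorem charFun_convPower (F : Measure ℝ) [IsProbabilityMeasure F] (k : ℕ) (ξ : ℝ) :
    charFun (convPower F k) ξ = charFun F ξ ^ k := by
  induction k with
  | zero => simp [convPower, charFun_dirac]
  | succ k ih => rw [convPower, charFun_conv, ih, pow_succ]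

instance isProbabilityMeasure_compoundPoissonMeasure (r : ℝ≥0) (F : Measure ℝ)
    [IsProbabilityMeasure F] : IsProbabilityMeasure (compoundPoissonMeasure r F) := by
  constructor
  rw [compoundPoissonMeasure, Measure.sum_apply _ MeasurableSet.univ]
  simp only [Measure.smul_apply, measure_univ, smul_eq_mul, mul_one]
  rw [← measure_univ (μ := poissonMeasure r), ← Measure.tsum_indicator_apply_singleton _ _
    MeasurableSet.univ]
  simp

theorem charFun_compoundPoissonMeasure (r : ℝ≥0) (F : Measure ℝ) [IsProbabilityMeasure F]
    (ξ : ℝ) :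
    charFun (compoundPoissonMeasure r F) ξ = Complex.exp (r * (charFun F ξ - 1)) := by
  have hi : Integrable (fun x : ℝ => Complex.exp (ξ * x * Complex.I))
      (compoundPoissonMeasure r F) := by
    refine (integrable_const (1 : ℝ)).mono' (by fun_prop) (ae_of_all _ fun x => ?_)
    rw [← Complex.ofReal_mul, Complex.norm_exp_ofReal_mul_I]
  have h1 := hasSum_integral_measure hi
  simp only [integral_smul_measure, ← charFun_apply_real, charFun_convPower] at h1
  change HasSum _ (charFun (compoundPoissonMeasure r F) ξ) at h1
  have h2 := (NormedSpace.expSeries_div_hasSum_exp ((r : ℂ) * charFun F ξ)).mul_left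
    (Complex.exp (-(r : ℂ)))
  rw [← Complex.exp_eq_exp_ℂ, ← Complex.exp_add] at h2
  rw [show (r : ℂ) * (charFun F ξ - 1) = -(r : ℂ) + r * charFun F ξ by ring]
  refine h1.unique (h2.congr_fun ?_)
  intro k
  rw [← measureReal_def, poissonMeasure_real_singleton, Complex.real_smul]
  push_cast
  ring

theorem exp_neg_le_compoundPoissonMeasure_singleton_zero (r : ℝ≥0) (F : Measure ℝ) :
    ENNReal.ofReal (Real.exp (-r)) ≤ compoundPoissonMeasure r F {0} := by
  rw [compoundPoissonMeasure, Measure.sum_apply _ (measurableSet_singleton 0)]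
  refine le_trans ?_ (ENNReal.le_tsum 0)
  simp [convPower, poissonMeasure_singleton]

/-- The power is `exp (m log (1 + w))`. Writing `log (1 + w)` as `w` times its difference quotient,
continuous at `0` with value `1`, also covers `w = 0`. -/
theorem tendsto_one_add_pow_exp {ι : Type*} {l : Filter ι} {w : ι → ℂ} {m : ι → ℕ} {z : ℂ}
    (hw : Tendsto w l (𝓝 0)) (hm : Tendsto (fun i => m i * w i) l (𝓝 z)) :
    Tendsto (fun i => (1 + w i) ^ m i) l (𝓝 (Complex.exp z)) := by
  have hd : HasDerivAt (fun w : ℂ => Complex.log (1 + w)) 1 0 := by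
    simpa using ((hasDerivAt_id (0 : ℂ)).const_add 1).clog (by simp)
  have hk := (continuousAt_dslope_same.2 hd.differentiableAt).tendsto.comp hw
  rw [dslope_same, hd.deriv] at hk
  have h := (Complex.continuous_exp.tendsto _).comp (hm.mul hk)
  rw [mul_one] at h
  refine h.congr' ?_
  filter_upwards [hw.eventually_ne (show (0 : ℂ) ≠ -1 by simp)] with i hi
  have hs := sub_smul_dslope (fun w : ℂ => Complex.log (1 + w)) 0 (w i)
  simp only [sub_zero, smul_eq_mul, add_zero, Complex.log_one] at hs
  have h0 : 1 + w i ≠ 0 := fun h => hi (by linear_combination h)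
  simp only [Function.comp_apply, mul_assoc]
  rw [hs, Complex.exp_nat_mul, Complex.exp_log h0]

theorem tendsto_nat_mul_one_sub_exp_neg_div (c : ℝ) :
    Tendsto (fun n : ℕ => ((n : ℝ) + 1) * (1 - Real.exp (-c / (n + 1)))) atTop (𝓝 c) := by
  have hd : HasDerivAt (fun x : ℝ => 1 - Real.exp (-c * x)) c 0 := by
    have := (((hasDerivAt_id (0 : ℝ)).const_mul (-c)).exp).const_sub 1
    simpa using this
  have h := hd.tendsto_slope_zero_right.comp (tendsto_nhdsWithin_iff.2
    ⟨tendsto_one_div_add_atTop_nhds_zero_nat (𝕜 := ℝ), Eventually.of_forall fun n => by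
      simp only [Set.mem_Ioi]; positivity⟩)
  refine h.congr fun n => ?_
  simp
  left
  ring

theorem tendsto_ceil_mul_div (s : ℝ≥0) :
    Tendsto (fun n : ℕ => (⌈s * (n + 1)⌉₊ : ℝ≥0) / (n + 1)) atTop (𝓝[≥] s) := by
  have hle (n : ℕ) : s ≤ (⌈s * (n + 1)⌉₊ : ℝ≥0) / (n + 1) := by
    rw [le_div_iff₀ (by positivity)]
    exact Nat.le_ceil _
  have h : Tendsto (fun n : ℕ => s + 1 / ((n : ℝ≥0) + 1)) atTop (𝓝 (s + 0)) :=
    tendsto_const_nhds.add tendsto_one_div_add_atTop_nhds_zero_nat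
  rw [add_zero] at h
  refine tendsto_nhdsWithin_iff.2 ⟨?_, Eventually.of_forall hle⟩
  refine tendsto_of_tendsto_of_tendsto_of_le_of_le tendsto_const_nhds h hle fun n => ?_
  simp only
  rw [div_le_iff₀ (by positivity), add_mul, one_div, inv_mul_cancel₀ (by positivity)]
  exact (Nat.ceil_lt_add_one zero_le).le

/-! ### Increments of Lévy processes and zeros of subordinators -/

namespace IsLevyProcess

variable {Ω : Type*} [MeasurableSpace Ω] {X : ℝ≥0 → Ω → ℝ} {P : Measure Ω}

theorem map_increment (h : IsLevyProcess X P) (s t : ℝ≥0) :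
    P.map (X (s + t) - X s) = P.map (X t) := by
  refine (h.stationary_increments s t).map_eq.trans ?_
  refine Measure.map_congr ?_
  filter_upwards [h.start_zero] with ω hω
  simp [hω]

theorem indepFun_increment (h : IsLevyProcess X P) (s t : ℝ≥0) :
    (X s) ⟂ᵢ[P] (X (s + t) - X s) :=
  h.indep_increments.indepFun_eval_sub (zero_le (a := s)) le_self_add h.start_zero

theorem charFun_map_add [IsProbabilityMeasure P] (h : IsLevyProcess X P) (s t : ℝ≥0) (ξ : ℝ) :
    charFun (P.map (X (s + t))) ξ = charFun (P.map (X s)) ξ * charFun (P.map (X t)) ξ := by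
  have h1 := (h.indepFun_increment s t).charFun_map_add_eq_mul (h.measurable s).aemeasurable
    ((h.measurable (s + t)).sub (h.measurable s)).aemeasurable
  have h2 := h.map_increment s t
  rw [add_sub_cancel] at h1
  rw [h1, Pi.mul_apply, h2]

theorem charFun_map_nsmul [IsProbabilityMeasure P] (h : IsLevyProcess X P) (n : ℕ) (t : ℝ≥0)
    (ξ : ℝ) : charFun (P.map (X (n • t))) ξ = charFun (P.map (X t)) ξ ^ n := by
  induction n with
  | zero =>
    have : P.map (X 0) = Measure.dirac 0 := by
      rw [Measure.map_congr (g := fun _ => (0 : ℝ)) h.start_zero, Measure.map_const]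
      simp
    simp [this, charFun_dirac]
  | succ n ih => rw [succ_nsmul, h.charFun_map_add, ih, pow_succ]

theorem charFun_map_eq_integral (h : IsLevyProcess X P) (t : ℝ≥0) (ξ : ℝ) :
    charFun (P.map (X t)) ξ = ∫ ω, Complex.exp (ξ * X t ω * Complex.I) ∂P := by
  rw [charFun_apply_real, integral_map (h.measurable t).aemeasurable (by fun_prop)]

theorem tendsto_charFun_map [IsProbabilityMeasure P] (h : IsLevyProcess X P) {u : ℕ → ℝ≥0}
    {t : ℝ≥0} (hu : Tendsto u atTop (𝓝 t)) (hle : ∀ᶠ n in atTop, t ≤ u n) (ξ : ℝ) :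
    Tendsto (fun n => charFun (P.map (X (u n))) ξ) atTop (𝓝 (charFun (P.map (X t)) ξ)) := by
  simp only [h.charFun_map_eq_integral]
  refine tendsto_integral_of_dominated_convergence (fun _ => 1)
    (fun n => ?_) (integrable_const 1) (fun n => ae_of_all _ fun ω => ?_) ?_
  · have := h.measurable (u n)
    fun_prop
  · rw [← Complex.ofReal_mul, Complex.norm_exp_ofReal_mul_I]
  · filter_upwards [h.right_continuous] with ω hω
    have h1 : Tendsto (fun n => X (u n) ω) atTop (𝓝 (X t ω)) :=
      (hω t).tendsto.comp (tendsto_nhdsWithin_iff.2 ⟨hu, hle⟩)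
    have hc : Continuous fun x : ℝ => Complex.exp (ξ * x * Complex.I) := by fun_prop
    exact (hc.tendsto _).comp h1

theorem measure_increment_preimage (h : IsLevyProcess X P) (s t : ℝ≥0) {A : Set ℝ}
    (hA : MeasurableSet A) : P ((X (s + t) - X s) ⁻¹' A) = P (X t ⁻¹' A) := by
  rw [← Measure.map_apply ((h.measurable (s + t)).sub (h.measurable s)) hA, h.map_increment,
    Measure.map_apply (h.measurable t) hA]

theorem measure_increment_ne_zero (h : IsLevyProcess X P) (s t : ℝ≥0) :
    P {ω | X (s + t) ω ≠ X s ω} = P {ω | X t ω ≠ 0} := by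
  have h1 := h.measure_increment_preimage s t (measurableSet_singleton 0).compl
  simpa [Set.preimage, sub_eq_zero] using h1

theorem tendsto_div_nat [IsProbabilityMeasure P] (h : IsLevyProcess X P)
    (hint : Integrable (X 1) P) :
    ∀ᵐ ω ∂P, Tendsto (fun n : ℕ => X n ω / n) atTop (𝓝 (∫ ω, X 1 ω ∂P)) := by
  let Y : ℕ → Ω → ℝ := fun i ω => X (i + 1) ω - X i ω
  have hid (i : ℕ) : IdentDistrib (Y i) (X 1) P P :=
    ⟨((h.measurable _).sub (h.measurable _)).aemeasurable, (h.measurable 1).aemeasurable,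
      h.map_increment i 1⟩
  have hind : iIndepFun Y P := by
    have := h.indep_increments.nat (t := fun n : ℕ => (n : ℝ≥0)) Nat.mono_cast
    simpa [Y] using this
  have hsl := strong_law_ae_real Y ((hid 0).integrable_iff.2 hint)
    (fun i j hij => hind.indepFun hij) (fun i => (hid i).trans (hid 0).symm)
  rw [(hid 0).integral_eq] at hsl
  filter_upwards [hsl, h.start_zero] with ω hω h0
  refine hω.congr fun n => ?_
  have := Finset.sum_range_sub (fun i : ℕ => X (i : ℝ≥0) ω) n
  simp only [Nat.cast_add, Nat.cast_one, Nat.cast_zero, h0, sub_zero] at this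
  rw [← this]

end IsLevyProcess

namespace IsSubordinator

variable {Ω : Type*} [MeasurableSpace Ω] {X : ℝ≥0 → Ω → ℝ} {P : Measure Ω}

theorem ae_nonneg (h : IsSubordinator X P) : ∀ᵐ ω ∂P, ∀ t, 0 ≤ X t ω := by
  filter_upwards [h.monotone, h.start_zero] with ω hm h0 t
  exact h0 ▸ hm (zero_le (a := t))

/-- For a non-negative non-decreasing path, vanishing at `s + t` means that both independent
increments vanish. -/
theorem measure_eq_zero_add (h : IsSubordinator X P) (s t : ℝ≥0) :
    P {ω | X (s + t) ω = 0} = P {ω | X s ω = 0} * P {ω | X t ω = 0} := by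
  have hm : MeasurableSet ({0} : Set ℝ) := measurableSet_singleton 0
  have h1 := (h.indepFun_increment s t).measure_inter_preimage_eq_mul {0} {0} hm hm
  have h2 := h.measure_increment_preimage s t hm
  change _ = P (X s ⁻¹' {0}) * P (X t ⁻¹' {0})
  rw [← h2]
  refine Eq.trans (measure_congr ?_) h1
  filter_upwards [h.monotone, h.ae_nonneg] with ω hmono h0
  have h3 := hmono (le_self_add : s ≤ s + t)
  have h4 := h0 s
  refine propext ⟨fun h5 => ?_, fun h5 => ?_⟩
  · change X (s + t) ω = 0 at h5
    have h6 : X s ω = 0 := le_antisymm (by simpa [h5] using h3) h4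
    exact ⟨h6, by simp [h5, h6]⟩
  · have h6 : X s ω = 0 := h5.1
    have h7 : X (s + t) ω - X s ω = 0 := h5.2
    change X (s + t) ω = 0
    linarith

theorem measure_eq_zero_nsmul [IsProbabilityMeasure P] (h : IsSubordinator X P) (n : ℕ)
    (t : ℝ≥0) : P {ω | X (n • t) ω = 0} = P {ω | X t ω = 0} ^ n := by
  induction n with
  | zero =>
    rw [zero_nsmul, pow_zero, ← measure_univ (μ := P)]
    refine measure_congr ?_
    filter_upwards [h.start_zero] with ω hω
    exact eq_true hω
  | succ n ih => rw [succ_nsmul, h.measure_eq_zero_add, ih, pow_succ]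

theorem measure_eq_zero_of_pos [IsProbabilityMeasure P] (h : IsSubordinator X P)
    (h1 : P {ω | X 1 ω = 0} = 0) {t : ℝ≥0} (ht : 0 < t) : P {ω | X t ω = 0} = 0 := by
  obtain ⟨n, hn⟩ := exists_nat_gt (1 / t)
  have hle : 1 ≤ n • t := by
    rw [nsmul_eq_mul]
    exact ((div_lt_iff₀ ht).1 hn).le
  have h2 : P {ω | X (n • t) ω = 0} = 0 := by
    refine le_antisymm (le_trans (measure_mono_ae ?_) h1.le) (zero_le)
    filter_upwards [h.monotone, h.ae_nonneg] with ω hm h0 (h3 : X (n • t) ω = 0)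
    exact le_antisymm (h3 ▸ hm hle) (h0 1)
  rw [h.measure_eq_zero_nsmul] at h2
  exact eq_zero_of_pow_eq_zero h2

/-- Almost surely no two times of a countable dense set share a value; two such times fit between
any `s < t`. -/
theorem ae_strictMono [IsProbabilityMeasure P] (h : IsSubordinator X P)
    (h1 : P {ω | X 1 ω = 0} = 0) : ∀ᵐ ω ∂P, StrictMono (fun t => X t ω) := by
  obtain ⟨S, hSc, hSd⟩ := TopologicalSpace.exists_countable_dense ℝ≥0
  have hne : ∀ᵐ ω ∂P, ∀ q ∈ S, ∀ r ∈ S, q < r → X r ω ≠ X q ω := by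
    refine (ae_ball_iff hSc).2 fun q _ => (ae_ball_iff hSc).2 fun r _ => ?_
    refine ae_all_iff.2 fun hqr => ?_
    obtain ⟨t, rfl⟩ := exists_add_of_le hqr.le
    have h2 := h.measure_eq_zero_of_pos h1 (show 0 < t by simpa using hqr)
    have h3 := h.measure_increment_preimage q t (measurableSet_singleton 0)
    rw [ae_iff]
    refine Eq.trans (congrArg P ?_) (h3.trans h2)
    ext ω
    simp [sub_eq_zero]
  filter_upwards [hne, h.monotone] with ω hω hm s t hst
  obtain ⟨q, hq, hsq, hqt⟩ := hSd.exists_between hst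
  obtain ⟨r, hr, hqr, hrt⟩ := hSd.exists_between hqt
  calc X s ω ≤ X q ω := hm hsq.le
    _ < X r ω := lt_of_le_of_ne (hm hqr.le) (hω q hq r hr hqr).symm
    _ ≤ X t ω := hm hrt.le

end IsSubordinator

/-! ### Subordinators with an atom at zero are compound Poisson -/

theorem charFun_eq_of_cond_ne_zero (μ : Measure ℝ) [IsProbabilityMeasure μ]
    (h : μ {0}ᶜ ≠ 0) (ξ : ℝ) :
    charFun μ ξ = 1 - μ.real {0}ᶜ * (1 - charFun μ[|{0}ᶜ] ξ) := by
  have hm : MeasurableSet ({0} : Set ℝ) := measurableSet_singleton 0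
  have hi : Integrable (fun x : ℝ => Complex.exp (ξ * x * Complex.I)) μ := by
    refine (integrable_const (1 : ℝ)).mono' (by fun_prop) (ae_of_all _ fun x => ?_)
    rw [← Complex.ofReal_mul, Complex.norm_exp_ofReal_mul_I]
  have h0 : μ.real {0}ᶜ ≠ 0 := (measureReal_ne_zero_iff).2 h
  have h1 : μ.real {0} = 1 - μ.real {0}ᶜ := by
    rw [probReal_compl_eq_one_sub hm]; ring
  simp only [charFun_apply_real]
  rw [← integral_add_compl hm hi, ProbabilityTheory.cond, integral_smul_measure, integral_singleton]
  rw [h1, ENNReal.toReal_inv, ← measureReal_def, Complex.real_smul, Complex.real_smul]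
  have h2 : ((μ.real {0}ᶜ : ℝ) : ℂ) ≠ 0 := by exact_mod_cast h0
  simp only [Complex.ofReal_zero, mul_zero, zero_mul, Complex.exp_zero]
  generalize ∫ x : ℝ in {0}ᶜ, Complex.exp (ξ * x * Complex.I) ∂μ = c
  push_cast
  field_simp
  ring

/-- The uniform tail bound gives tightness, hence relative compactness by Prokhorov. A limit along
an ultrafilter avoids passing to subsequences. -/
theorem exists_tendsto_hyperfilter_of_tail_le {F : ℕ → ProbabilityMeasure ℝ} {C : ℝ}
    (hF : ∀ n, ∀ r : ℝ, 0 < r → (F n : Measure ℝ) {x | r < ‖x‖} ≤ ENNReal.ofReal (C / r)) :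
    ∃ G : ProbabilityMeasure ℝ, Tendsto F (hyperfilter ℕ) (𝓝 G) := by
  have ht : IsTightMeasureSet {((μ : ProbabilityMeasure ℝ) : Measure ℝ) | μ ∈ Set.range F} := by
    refine isTightMeasureSet_of_tendsto_measure_norm_gt ?_
    have h0 : Tendsto (fun r : ℝ => ENNReal.ofReal (C / r)) atTop (𝓝 0) := by
      have := ENNReal.tendsto_ofReal (tendsto_const_nhds (x := C).div_atTop tendsto_id)
      simpa using this
    refine tendsto_of_tendsto_of_tendsto_of_le_of_le' tendsto_const_nhds h0
      (Eventually.of_forall fun _ => zero_le) ?_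
    filter_upwards [eventually_gt_atTop 0] with r hr
    refine iSup₂_le ?_
    rintro _ ⟨_, ⟨n, rfl⟩, rfl⟩
    exact hF n r hr
  obtain ⟨G, -, hG⟩ := (isCompact_closure_of_isTightMeasureSet ht).ultrafilter_le_nhds
    ((hyperfilter ℕ).map F) (by
      rw [Ultrafilter.coe_map, le_principal_iff, mem_map]
      exact Eventually.of_forall fun n => subset_closure ⟨n, rfl⟩)
  exact ⟨G, hG⟩

theorem tendsto_charFun_of_tendsto {ι : Type*} {l : Filter ι} {F : ι → ProbabilityMeasure ℝ}
    {G : ProbabilityMeasure ℝ} (h : Tendsto F l (𝓝 G)) (ξ : ℝ) :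
    Tendsto (fun i => charFun (F i : Measure ℝ) ξ) l (𝓝 (charFun (G : Measure ℝ) ξ)) := by
  rw [ProbabilityMeasure.tendsto_iff_forall_integral_rclike_tendsto ℂ] at h
  simp_rw [charFun_eq_integral_innerProbChar]
  exact h (BoundedContinuousFunction.innerProbChar ξ)

namespace IsLevyProcess

variable {Ω : Type*} [MeasurableSpace Ω] {X : ℝ≥0 → Ω → ℝ} {P : Measure Ω}

theorem integral_nsmul [IsProbabilityMeasure P] (h : IsLevyProcess X P) {t : ℝ≥0}
    (ht : Integrable (X t) P) (n : ℕ) :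
    Integrable (X (n • t)) P ∧ ∫ ω, X (n • t) ω ∂P = n * ∫ ω, X t ω ∂P := by
  induction n with
  | zero =>
    have h0 : X (0 • t) =ᵐ[P] fun _ => (0 : ℝ) := by
      rw [zero_nsmul]
      exact h.start_zero
    exact ⟨(integrable_zero _ _ _).congr h0.symm, by rw [integral_congr_ae h0]; simp⟩
  | succ n ih =>
    have hid : IdentDistrib (X (n • t + t) - X (n • t)) (X t) P P :=
      ⟨((h.measurable _).sub (h.measurable _)).aemeasurable, (h.measurable t).aemeasurable,
        h.map_increment _ t⟩
    have hi := hid.integrable_iff.2 ht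
    have he : X ((n + 1) • t) = X (n • t) + (X (n • t + t) - X (n • t)) := by
      rw [add_sub_cancel, succ_nsmul]
    rw [he]
    refine ⟨ih.1.add hi, ?_⟩
    rw [integral_add' ih.1 hi, ih.2, hid.integral_eq]
    push_cast
    ring

end IsLevyProcess

namespace IsSubordinator

variable {Ω : Type*} [MeasurableSpace Ω] {X : ℝ≥0 → Ω → ℝ} {P : Measure Ω}

theorem isCompoundPoisson_of_measure_eq_one [IsProbabilityMeasure P] (h : IsSubordinator X P)
    (h1 : P {ω | X 1 ω = 0} = 1) : IsCompoundPoisson X P := by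
  refine ⟨h.1, 0, Measure.dirac 0, inferInstance, fun t => ?_⟩
  obtain ⟨n, hn⟩ := exists_nat_ge t
  have h2 : ∀ᵐ ω ∂P, X (n • 1) ω = 0 := by
    refine (prob_compl_eq_zero_iff ((h.measurable _) (measurableSet_singleton 0))).2 ?_
    exact (h.measure_eq_zero_nsmul n 1).trans (by rw [h1, one_pow])
  have h3 : X t =ᵐ[P] fun _ => (0 : ℝ) := by
    filter_upwards [h2, h.monotone, h.ae_nonneg] with ω hω hm h0
    exact le_antisymm (hω ▸ hm (by simpa using hn)) (h0 t)
  rw [Measure.map_congr h3, Measure.map_const, measure_univ, one_smul]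
  refine Measure.ext_of_charFun (funext fun ξ => ?_)
  rw [charFun_compoundPoissonMeasure]
  simp [charFun_dirac]

/-- Markov's inequality, since `X (1 / (n + 1))` has mean `E X₁ / (n + 1)`. -/
theorem measure_norm_gt_le [IsProbabilityMeasure P] (h : IsSubordinator X P)
    (hint : Integrable (X 1) P) (n : ℕ) {r : ℝ} (hr : 0 < r) :
    (P.map (X (1 / (n + 1)))).real {x | r < ‖x‖} ≤ (∫ ω, X 1 ω ∂P) / ((n + 1) * r) := by
  have hle : (1 / (n + 1) : ℝ≥0) ≤ 1 := by
    rw [div_le_one (by positivity)]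
    exact le_add_self
  have hi : Integrable (X (1 / (n + 1))) P := by
    refine hint.mono' (h.measurable _).aestronglyMeasurable ?_
    filter_upwards [h.monotone, h.ae_nonneg] with ω hm h0
    rw [Real.norm_of_nonneg (h0 _)]
    exact hm hle
  have h1 := (h.integral_nsmul hi (n + 1)).2
  have h2 : ((n + 1 : ℕ) • (1 / (n + 1) : ℝ≥0)) = 1 := by
    rw [nsmul_eq_mul]
    push_cast
    field_simp
  rw [h2] at h1
  have h3 := mul_meas_ge_le_integral_of_nonneg (μ := P) (h.ae_nonneg.mono fun ω hω =>
    hω (1 / (n + 1))) hi r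
  have h4 : (P.map (X (1 / (n + 1)))).real {x | r < ‖x‖} ≤ P.real {ω | r ≤ X (1 / (n + 1)) ω} := by
    rw [measureReal_def, Measure.map_apply (h.measurable _)
      (measurableSet_lt measurable_const measurable_norm), measureReal_def]
    refine ENNReal.toReal_mono (measure_ne_top _ _) (measure_mono_ae ?_)
    filter_upwards [h.ae_nonneg] with ω h0 (h5 : r < ‖X _ ω‖)
    rw [Real.norm_of_nonneg (h0 _)] at h5
    exact h5.le
  rw [le_div_iff₀ (by positivity), h1]
  push_cast
  nlinarith [mul_le_mul_of_nonneg_right h4 hr.le]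

/-- With `q n` the probability that `X (1 / (n + 1))` is nonzero and `F n` its law given that event,
its characteristic function is `1 + q n * (charFun (F n) ξ - 1)`. About `t (n + 1)` such factors
multiply to that of `X t`, and the limit is the compound Poisson exponential. -/
theorem isCompoundPoisson [IsProbabilityMeasure P] (h : IsSubordinator X P)
    (hint : Integrable (X 1) P) (h1 : P {ω | X 1 ω = 0} ≠ 0) : IsCompoundPoisson X P := by
  -- If `p = 1`, every `q n` vanishes and there is nothing to condition on.
  by_cases h2 : P {ω | X 1 ω = 0} = 1
  · exact h.isCompoundPoisson_of_measure_eq_one h2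
  have hm0 : MeasurableSet ({0} : Set ℝ) := measurableSet_singleton 0
  set p : ℝ := P.real {ω | X 1 ω = 0} with hp
  have hp0 : 0 < p := ENNReal.toReal_pos h1 (measure_ne_top _ _)
  have hp1 : p < 1 := by
    refine lt_of_le_of_ne measureReal_le_one fun h3 => h2 ?_
    rw [hp, measureReal_def] at h3
    rw [← ENNReal.ofReal_toReal (measure_ne_top P _), h3, ENNReal.ofReal_one]
  let μ : ℕ → Measure ℝ := fun n => P.map (X (1 / (n + 1)))
  have hμ (n : ℕ) : IsProbabilityMeasure (μ n) :=
    Measure.isProbabilityMeasure_map (h.measurable _).aemeasurable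
  let q : ℕ → ℝ := fun n => (μ n).real {0}ᶜ
  have hpow (n : ℕ) : (1 - q n) ^ (n + 1) = p := by
    have h3 : ((n + 1 : ℕ) • (1 / (n + 1) : ℝ≥0)) = 1 := by
      rw [nsmul_eq_mul]
      push_cast
      field_simp
    have h4 := h.measure_eq_zero_nsmul (n + 1) (1 / (n + 1))
    rw [h3] at h4
    simp only [q]
    rw [← probReal_compl_eq_one_sub hm0.compl, compl_compl, measureReal_def,
      Measure.map_apply (h.measurable _) hm0, ← ENNReal.toReal_pow, hp, measureReal_def, h4]
    rfl
  have hq1 (n : ℕ) : q n ≤ 1 := measureReal_le_one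
  have hq0 (n : ℕ) : 0 < q n := by
    refine lt_of_le_of_ne measureReal_nonneg fun h3 => hp1.ne ?_
    rw [← hpow n, ← h3]
    simp
  have hqexp (n : ℕ) : q n = 1 - Real.exp (-(-Real.log p) / (n + 1)) := by
    have h3 : 0 < 1 - q n := by
      refine lt_of_le_of_ne (sub_nonneg.2 (hq1 n)) fun h3 => hp0.ne ?_
      rw [← hpow n, ← h3]
      simp
    have h4 : Real.log p = (n + 1) * Real.log (1 - q n) := by
      rw [← hpow n, Real.log_pow]
      push_cast
      ring
    rw [neg_neg, h4, mul_div_cancel_left₀ _ (by positivity), Real.exp_log h3]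
    ring
  have hqlim : Tendsto (fun n : ℕ => ((n : ℝ) + 1) * q n) atTop (𝓝 (-Real.log p)) := by
    simp only [hqexp]
    exact tendsto_nat_mul_one_sub_exp_neg_div _
  -- Bernoulli's inequality; this keeps the denominator in the tail bound for `F n` away from `0`.
  have hqge (n : ℕ) : 1 - p ≤ (n + 1) * q n := by
    have := one_add_mul_le_pow (a := -q n) (by linarith [hq1 n]) (n + 1)
    rw [← sub_eq_add_neg, hpow] at this
    push_cast at this
    linarith
  have hne (n : ℕ) : μ n {0}ᶜ ≠ 0 := (measureReal_ne_zero_iff).1 (hq0 n).ne'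
  let F : ℕ → ProbabilityMeasure ℝ := fun n => ⟨(μ n)[|{0}ᶜ], cond_isProbabilityMeasure (hne n)⟩
  have hρ : 0 ≤ ∫ ω, X 1 ω ∂P := integral_nonneg_of_ae (h.ae_nonneg.mono fun ω hω => hω 1)
  obtain ⟨G, hG⟩ : ∃ G : ProbabilityMeasure ℝ, Tendsto F (hyperfilter ℕ) (𝓝 G) := by
    refine exists_tendsto_hyperfilter_of_tail_le (C := (∫ ω, X 1 ω ∂P) / (1 - p))
      fun n r hr => ?_
    change (μ n)[|{0}ᶜ] _ ≤ _
    rw [ENNReal.le_ofReal_iff_toReal_le (measure_ne_top _ _)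
      (div_nonneg (div_nonneg hρ (by linarith)) hr.le), cond_apply hm0.compl,
      ENNReal.toReal_mul, ENNReal.toReal_inv, ← measureReal_def, ← measureReal_def]
    have h3 := h.measure_norm_gt_le hint n hr
    have h4 : (μ n).real ({0}ᶜ ∩ {x | r < ‖x‖}) ≤ (∫ ω, X 1 ω ∂P) / ((n + 1) * r) :=
      (measureReal_mono Set.inter_subset_right).trans h3
    calc (q n)⁻¹ * (μ n).real ({0}ᶜ ∩ {x | r < ‖x‖})
        ≤ (q n)⁻¹ * ((∫ ω, X 1 ω ∂P) / ((n + 1) * r)) := by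
          gcongr
      _ = (∫ ω, X 1 ω ∂P) / ((n + 1) * q n) / r := by
          have := (hq0 n).ne'
          field_simp
      _ ≤ (∫ ω, X 1 ω ∂P) / (1 - p) / r := by
          gcongr
          · exact hqge n
  have hU : ((hyperfilter ℕ : Ultrafilter ℕ) : Filter ℕ) ≤ atTop := Nat.hyperfilter_le_atTop
  refine ⟨h.1, Real.toNNReal (-Real.log p), G, inferInstance, fun t => ?_⟩
  have : IsProbabilityMeasure (P.map (X t)) :=
    Measure.isProbabilityMeasure_map (h.measurable t).aemeasurable
  refine Measure.ext_of_charFun (funext fun ξ => ?_)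
  rw [charFun_compoundPoissonMeasure]
  -- Rounding up makes `m n / (n + 1)` approach `t` from the right, where paths are continuous.
  let m : ℕ → ℕ := fun n => ⌈t * (n + 1)⌉₊
  have hmu (n : ℕ) : m n • (1 / (n + 1) : ℝ≥0) = (⌈t * (n + 1)⌉₊ : ℝ≥0) / (n + 1) := by
    rw [nsmul_eq_mul, mul_one_div]
  obtain ⟨hmlim, hmle⟩ := tendsto_nhdsWithin_iff.1 ((tendsto_ceil_mul_div t).congr fun n =>
    (hmu n).symm)
  have hL := (h.tendsto_charFun_map hmlim hmle ξ).mono_left hU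
  simp only [h.charFun_map_nsmul] at hL
  have hφ := (tendsto_charFun_of_tendsto hG ξ).sub_const 1
  have hqC : Tendsto (fun n : ℕ => (((n : ℝ) + 1 : ℝ) : ℂ) * q n) (hyperfilter ℕ)
      (𝓝 ((-Real.log p : ℝ) : ℂ)) := by
    have := (Complex.continuous_ofReal.tendsto _).comp (hqlim.mono_left hU)
    refine this.congr fun n => ?_
    simp
  have hinv : Tendsto (fun n : ℕ => ((1 / ((n : ℝ) + 1) : ℝ) : ℂ)) (hyperfilter ℕ) (𝓝 0) := by
    have := (Complex.continuous_ofReal.tendsto _).comp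
      ((tendsto_one_div_add_atTop_nhds_zero_nat (𝕜 := ℝ)).mono_left hU)
    rwa [Complex.ofReal_zero] at this
  have hmC : Tendsto (fun n : ℕ => (m n : ℂ) * ((1 / ((n : ℝ) + 1) : ℝ) : ℂ)) (hyperfilter ℕ)
      (𝓝 ((t : ℝ) : ℂ)) := by
    have := ((Complex.continuous_ofReal.comp NNReal.continuous_coe).tendsto _).comp
      (hmlim.mono_left hU)
    refine this.congr fun n => ?_
    simp
  have hc (n : ℕ) : (((n : ℝ) + 1 : ℝ) : ℂ) ≠ 0 := by
    exact_mod_cast (show (n : ℝ) + 1 ≠ 0 by positivity)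
  have hw := (hinv.mul hqC).mul hφ
  have hmw := (hmC.mul hqC).mul hφ
  have hlim := tendsto_one_add_pow_exp (l := hyperfilter ℕ) (m := m)
    (w := fun n => q n * (charFun (F n : Measure ℝ) ξ - 1))
    (by
      rw [zero_mul, zero_mul] at hw
      refine hw.congr fun n => ?_
      have := hc n
      rw [Complex.ofReal_div, Complex.ofReal_one]
      field_simp)
    (hmw.congr fun n => by
      have := hc n
      rw [Complex.ofReal_div, Complex.ofReal_one]
      field_simp)
  refine (tendsto_nhds_unique hL (hlim.congr fun n => ?_)).trans ?_
  · congr 1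
    have := charFun_eq_of_cond_ne_zero (μ n) (hne n) ξ
    simp only [μ, F, q] at this ⊢
    rw [this]
    simp only [ProbabilityMeasure.coe_mk]
    ring
  · congr 2
    have : 0 ≤ -Real.log p := neg_nonneg.2 (Real.log_nonpos hp0.le hp1.le)
    rw [NNReal.coe_mul, Real.coe_toNNReal _ this, Complex.ofReal_mul, mul_comm]

end IsSubordinator

/-! ### Finitely many values on bounded intervals -/

theorem card_image_range_succ_le {α : Type*} [DecidableEq α] (f : ℕ → α) (N : ℕ) :
    ((Finset.range (N + 1)).image f).card ≤
      1 + ((Finset.range N).filter fun k => f (k + 1) ≠ f k).card := by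
  induction N with
  | zero => simp
  | succ N ih =>
    rw [Finset.range_add_one, Finset.image_insert, Finset.range_add_one (n := N),
      Finset.filter_insert, ← Finset.range_add_one]
    split_ifs with hN
    · rw [Finset.card_insert_of_notMem (s := Finset.filter _ _) (by simp)]
      have := Finset.card_insert_le (f (N + 1)) ((Finset.range (N + 1)).image f)
      omega
    · rw [Finset.insert_eq_of_mem]
      · exact ih
      · rw [not_not.1 hN]
        exact Finset.mem_image_of_mem f (Finset.self_mem_range_succ N)

/-- A right-continuous path with infinitely many values on a bounded interval changes its value
arbitrarily often along fine enough regular grids. -/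
theorem eventually_le_card_filter_of_infinite_image {f : ℝ≥0 → ℝ}
    (hf : ∀ t, ContinuousWithinAt f (Set.Ici t) t) {M : ℕ}
    (hinf : (f '' Set.Iic (M : ℝ≥0)).Infinite) (m : ℕ) :
    ∀ᶠ n : ℕ in atTop, m ≤ ((Finset.range (M * (n + 1))).filter fun k : ℕ =>
      f (((k + 1 : ℕ) : ℝ≥0) / (n + 1)) ≠ f ((k : ℝ≥0) / (n + 1))).card := by
  classical
  -- Pick `m + 1` times with distinct values. By right-continuity, rounding them up to a fine grid
  -- keeps the values distinct, which forces at least `m` changes.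
  obtain ⟨S', hS', hbij⟩ := Set.SurjOn.exists_bijOn_subset (Set.surjOn_image f (Set.Iic (M : ℝ≥0)))
  have hS'inf : S'.Infinite := fun h => hinf (hbij.image_eq ▸ h.image f)
  obtain ⟨S, hS, hcard⟩ := hS'inf.exists_subset_card_eq (m + 1)
  have hd (s : ℝ≥0) : Tendsto (fun n : ℕ => f ((⌈s * (n + 1)⌉₊ : ℝ≥0) / (n + 1))) atTop
      (𝓝 (f s)) := (hf s).tendsto.comp (tendsto_ceil_mul_div s)
  have hev : ∀ᶠ n : ℕ in atTop, ∀ a ∈ S, ∀ b ∈ S, a ≠ b →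
      f ((⌈a * (n + 1)⌉₊ : ℝ≥0) / (n + 1)) ≠ f ((⌈b * (n + 1)⌉₊ : ℝ≥0) / (n + 1)) := by
    refine (Finset.eventually_all S).2 fun a ha => (Finset.eventually_all S).2 fun b hb => ?_
    refine eventually_imp_distrib_left.2 fun hab => ?_
    have hne : f a ≠ f b := fun h => hab (hbij.injOn (hS ha) (hS hb) h)
    exact (((hd a).sub (hd b)).eventually_ne (sub_ne_zero.2 hne)).mono fun _ => sub_ne_zero.1
  filter_upwards [hev] with n hn
  have h1 := card_image_range_succ_le (fun k : ℕ => f ((k : ℝ≥0) / (n + 1))) (M * (n + 1))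
  have h2 : S.card ≤
      ((Finset.range (M * (n + 1) + 1)).image fun k : ℕ => f ((k : ℝ≥0) / (n + 1))).card := by
    refine Finset.card_le_card_of_injOn (fun s => f ((⌈s * (n + 1)⌉₊ : ℝ≥0) / (n + 1)))
      (fun s hs => ?_) fun a ha b hb hab => ?_
    · refine Finset.mem_image_of_mem _ (Finset.mem_range.2 (Nat.lt_succ_of_le ?_))
      refine Nat.ceil_le.2 ?_
      push_cast
      have := hS' (hS hs)
      gcongr
      exact this
    · by_contra hne
      exact hn a ha b hb hne hab
  omega

namespace IsLevyProcess

variable {Ω : Type*} [MeasurableSpace Ω] {X : ℝ≥0 → Ω → ℝ} {P : Measure Ω}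

/-- The expected number of changes along a grid on `[0, M]` is at most `M l`, whatever the mesh. By
Fatou its liminf is almost surely finite, whereas infinitely many values would make it infinite. -/
theorem ae_finite_image_Iic [IsProbabilityMeasure P] (h : IsLevyProcess X P) {l : ℝ≥0}
    (hl : ∀ t : ℝ≥0, P {ω | X t ω ≠ 0} ≤ l * t) :
    ∀ᵐ ω ∂P, ∀ M : ℕ, ((fun s => X s ω) '' Set.Iic (M : ℝ≥0)).Finite := by
  classical
  refine ae_all_iff.2 fun M => ?_
  let A : ℕ → ℕ → Set Ω := fun n k =>
    {ω | X (((k + 1 : ℕ) : ℝ≥0) / (n + 1)) ω ≠ X ((k : ℝ≥0) / (n + 1)) ω}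
  have hA (n k : ℕ) : MeasurableSet (A n k) :=
    (measurableSet_eq_fun (h.measurable _) (h.measurable _)).compl
  let C : ℕ → Ω → ℝ≥0∞ := fun n ω =>
    ∑ k ∈ Finset.range (M * (n + 1)), (A n k).indicator (fun _ => 1) ω
  have hC (n : ℕ) : Measurable (C n) :=
    Finset.measurable_sum _ fun k _ => measurable_const.indicator (hA n k)
  have hCint (n : ℕ) : ∫⁻ ω, C n ω ∂P ≤ M * l := by
    simp only [C]
    rw [lintegral_finsetSum _ fun k _ => measurable_const.indicator (hA n k)]
    have hk (k : ℕ) : ∫⁻ ω, (A n k).indicator (fun _ => 1) ω ∂P ≤ l * (1 / (n + 1) : ℝ≥0) := by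
      rw [lintegral_indicator (hA n k), setLIntegral_one]
      refine le_trans (le_of_eq ?_) (hl _)
      rw [← h.measure_increment_ne_zero ((k : ℝ≥0) / (n + 1)), ← add_div]
      simp only [A, Nat.cast_add, Nat.cast_one]
    refine (Finset.sum_le_card_nsmul _ _ _ fun k _ => hk k).trans (le_of_eq ?_)
    rw [Finset.card_range, nsmul_eq_mul]
    norm_cast
    push_cast
    field_simp
  have hlim : ∀ᵐ ω ∂P, liminf (fun n => C n ω) atTop < ∞ := by
    refine ae_lt_top (Measurable.liminf hC) (ne_top_of_le_ne_top (b := (M : ℝ≥0∞) * l)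
      (ENNReal.mul_ne_top (by simp) (by simp)) ((lintegral_liminf_le hC).trans ?_))
    refine liminf_le_of_le (by isBoundedDefault) fun b hb => ?_
    obtain ⟨n, hn⟩ := hb.exists
    exact hn.trans (hCint n)
  filter_upwards [hlim, h.right_continuous] with ω hω hr
  by_contra hinf
  refine hω.ne (top_unique (ENNReal.iSup_natCast ▸ iSup_le fun m => ?_))
  refine le_liminf_of_le (by isBoundedDefault) ?_
  filter_upwards [eventually_le_card_filter_of_infinite_image hr hinf m] with n hn
  have : C n ω = ((Finset.range (M * (n + 1))).filter fun k : ℕ =>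
      X (((k + 1 : ℕ) : ℝ≥0) / (n + 1)) ω ≠ X ((k : ℝ≥0) / (n + 1)) ω).card := by
    simp only [C, A, Set.indicator_apply, Set.mem_ofPred_eq]
    rw [Finset.sum_boole]
  rw [this]
  exact_mod_cast hn

end IsLevyProcess

/-- The event of no jumps alone gives `P(X t = 0) ≥ exp (-l t) ≥ 1 - l t`. -/
theorem IsCompoundPoisson.exists_measure_ne_zero_le {Ω : Type*} [MeasurableSpace Ω]
    {X : ℝ≥0 → Ω → ℝ} {P : Measure Ω} [IsProbabilityMeasure P] (h : IsCompoundPoisson X P) :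
    ∃ l : ℝ≥0, ∀ t : ℝ≥0, P {ω | X t ω ≠ 0} ≤ l * t := by
  obtain ⟨hL, l, F, hF, hlaw⟩ := h
  refine ⟨l, fun t => ?_⟩
  have hm : MeasurableSet ({0} : Set ℝ) := measurableSet_singleton 0
  have h1 := exp_neg_le_compoundPoissonMeasure_singleton_zero (l * t) F
  rw [← hlaw t, Measure.map_apply (hL.measurable t) hm] at h1
  have h2 : {ω | X t ω ≠ 0} = (X t ⁻¹' {0})ᶜ := rfl
  rw [h2, prob_compl_eq_one_sub (hL.measurable t hm), tsub_le_iff_right]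
  refine le_trans ?_ (add_le_add_right h1 _)
  rw [← ENNReal.coe_mul, ← ENNReal.ofReal_coe_nnreal (p := l * t),
    ← ENNReal.ofReal_add (by positivity) (by positivity), ← ENNReal.ofReal_one]
  refine ENNReal.ofReal_le_ofReal ?_
  linarith [Real.add_one_le_exp (-((l * t : ℝ≥0) : ℝ))]

/-! ### The overtaking sequence along a fixed path -/

section Overtaking

variable {Ω : Type*} {J : ℝ≥0 → Ω → ℝ} {a v : ℝ} {ω : Ω}

theorem overtakingTime_pos (hv : 0 < v) (h0 : ∀ t, 0 ≤ J t ω) (n : ℕ) :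
    0 < overtakingTime J a v n ω := by
  cases n with
  | zero => exact hv
  | succ n => exact add_pos_of_pos_of_nonneg hv (h0 _)

theorem overtakingTime_monotone (ha : 0 ≤ a) (h0 : ∀ t, 0 ≤ J t ω)
    (hm : Monotone fun t => J t ω) : Monotone fun n => overtakingTime J a v n ω := by
  refine monotone_nat_of_le_succ fun n => ?_
  induction n with
  | zero => exact le_add_of_nonneg_right (h0 _)
  | succ n ih =>
    exact add_le_add_right (hm (Real.toNNReal_le_toNNReal (mul_le_mul_of_nonneg_left ih ha))) v

theorem overtakingTime_strictMono (ha : 0 < a) (hv : 0 < v) (h0 : J 0 ω = 0)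
    (hm : StrictMono fun t => J t ω) : StrictMono fun n => overtakingTime J a v n ω := by
  have hnn (t : ℝ≥0) : 0 ≤ J t ω := h0 ▸ hm.monotone (zero_le (a := t))
  have hpos (n : ℕ) : 0 < a * overtakingTime J a v n ω := mul_pos ha (overtakingTime_pos hv hnn n)
  refine strictMono_nat_of_lt_succ fun n => ?_
  induction n with
  | zero =>
    refine lt_add_of_pos_right v ?_
    have := hm (Real.toNNReal_pos.2 (hpos 0))
    exact h0 ▸ this
  | succ n ih =>
    refine add_lt_add_right (hm ?_) v
    exact (Real.toNNReal_lt_toNNReal_iff (hpos _)).2 (mul_lt_mul_of_pos_left ih ha)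

theorem overtakingTime_le (ha : 0 ≤ a) (ha1 : a ≤ 1) (h0 : ∀ t, 0 ≤ J t ω)
    (hm : Monotone fun t => J t ω) {M : ℝ≥0} (hM : v + J M ω ≤ M) (n : ℕ) :
    overtakingTime J a v n ω ≤ M := by
  induction n with
  | zero => exact (le_add_of_nonneg_right (h0 M)).trans hM
  | succ n ih =>
    refine le_trans (add_le_add_right (hm ?_) v) hM
    rw [Real.toNNReal_le_iff_le_coe]
    calc a * overtakingTime J a v n ω ≤ a * M := mul_le_mul_of_nonneg_left ih ha
      _ ≤ M := mul_le_of_le_one_left M.2 ha1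

theorem overtakingCount_eq_top_of_strictMono
    (h : StrictMono fun n => overtakingTime J a v n ω) : overtakingCount J a v ω = ⊤ := by
  have : {n : ℕ | 1 ≤ n ∧ overtakingTime J a v n ω = overtakingTime J a v (n - 1) ω} = ∅ := by
    refine Set.eq_empty_of_forall_notMem fun n hn => ?_
    have := h.injective hn.2
    have := hn.1
    omega
  rw [overtakingCount, this, Set.image_empty, sInf_empty]

/-- The barrier `M` confines the times `T_{n+1}` to `v` plus a finite set. By pigeonhole two agree,
and monotonicity makes the terms between them equal. -/
theorem overtakingCount_lt_top_of_finite_image (ha : 0 ≤ a) (ha1 : a ≤ 1) (h0 : ∀ t, 0 ≤ J t ω)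
    (hm : Monotone fun t => J t ω) {M : ℝ≥0} (hM : v + J M ω ≤ M)
    (hfin : ((fun s => J s ω) '' Set.Iic M).Finite) : overtakingCount J a v ω < ⊤ := by
  have hmaps (n : ℕ) : overtakingTime J a v (n + 1) ω ∈
      (fun x => v + x) '' ((fun s => J s ω) '' Set.Iic M) := by
    refine Set.mem_image_of_mem _ (Set.mem_image_of_mem _ ?_)
    refine Set.mem_Iic.2 (Real.toNNReal_le_iff_le_coe.2 ?_)
    calc a * overtakingTime J a v n ω ≤ a * M :=
          mul_le_mul_of_nonneg_left (overtakingTime_le ha ha1 h0 hm hM n) ha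
      _ ≤ M := mul_le_of_le_one_left M.2 ha1
  obtain ⟨i, j, hij, he⟩ := (hfin.image _).exists_lt_map_eq_of_forall_mem hmaps
  have hmono := overtakingTime_monotone (v := v) ha h0 hm
  have h1 : overtakingTime J a v (i + 1 + 1) ω = overtakingTime J a v (i + 1) ω :=
    le_antisymm ((hmono (by omega : i + 1 + 1 ≤ j + 1)).trans he.ge) (hmono (Nat.le_succ _))
  refine lt_of_le_of_lt (sInf_le ⟨i + 1 + 1, ⟨by omega, ?_⟩, rfl⟩) (WithTop.coe_lt_top (i + 1 + 1))
  exact h1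

end Overtaking

theorem proposition1 {Ω : Type*} [MeasurableSpace Ω] (P : Measure Ω) [IsProbabilityMeasure P]
    (J₁ : ℝ≥0 → Ω → ℝ) (hJ : IsSubordinator J₁ P)
    (hint : Integrable (J₁ 1) P) (hρ : ∫ ω, J₁ 1 ω ∂P < 1)
    (b₁ b₂ : ℝ) (hb₂ : 0 ≤ b₂) (hb : b₂ < b₁) (v : ℝ) (hv : 0 < v) :
    (IsCompoundPoisson J₁ P → ∀ᵐ ω ∂P, overtakingCount J₁ (1 - b₂ / b₁) v ω < ⊤) ∧
    (¬ IsCompoundPoisson J₁ P → ∀ᵐ ω ∂P, overtakingCount J₁ (1 - b₂ / b₁) v ω = ⊤) := by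
  have hb₁ : 0 < b₁ := hb₂.trans_lt hb
  have ha : 0 < 1 - b₂ / b₁ := sub_pos.2 ((div_lt_one hb₁).2 hb)
  have ha1 : 1 - b₂ / b₁ ≤ 1 := sub_le_self 1 (div_nonneg hb₂ hb₁.le)
  refine ⟨fun hcp => ?_, fun hcp => ?_⟩
  · obtain ⟨l, hl⟩ := hcp.exists_measure_ne_zero_le
    filter_upwards [hJ.ae_finite_image_Iic hl, hJ.tendsto_div_nat hint, hJ.monotone,
      hJ.ae_nonneg] with ω hfin hlim hm h0
    -- The limit is below `1`, so a large integer `n` satisfies `v + J₁ n ω < n` and serves as the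
    -- barrier.
    have h1 : Tendsto (fun n : ℕ => v / n + J₁ n ω / n) atTop (𝓝 (0 + ∫ ω, J₁ 1 ω ∂P)) :=
      (tendsto_const_div_atTop_nhds_zero_nat v).add hlim
    rw [zero_add] at h1
    obtain ⟨n, hn, hn0⟩ := ((h1.eventually_lt_const hρ).and (eventually_gt_atTop 0)).exists
    rw [← add_div, div_lt_one (by exact_mod_cast hn0)] at hn
    exact overtakingCount_lt_top_of_finite_image ha.le ha1 h0 hm (M := n)
      (by simpa using hn.le) (hfin n)
  · have h1 : P {ω | J₁ 1 ω = 0} = 0 := by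
      by_contra h1
      exact hcp (hJ.isCompoundPoisson hint h1)
    filter_upwards [hJ.ae_strictMono h1, hJ.start_zero] with ω hm h0
    exact overtakingCount_eq_top_of_strictMono (overtakingTime_strictMono ha hv h0 hm)
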